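/- Let $p$ be a fixed odd prime; for $n\ge 0$ let $V=\mathbb F_p^n$ and $N=|V|=p^n$. For $R,X,Y\subseteq V$ let $e_{G_R}(X,Y)$ be the number of pairs $(x,y)\in X\times Y$ with $y-x\in R$, i.e. the number of edges between $X$ and $Y$ in the bipartite Cayley graph generated by $R$. Fix an error function $\omega(\sigma,N)$ (the $o_\sigma(1)$ below), i.e. a real function such that for every $\delta>0$, for all sufficiently small $\sigma>0$ one has $|\omega(\sigma,N)|\le\delta$ for all sufficiently large $N$. For $\sigma>0$, a set $R\subseteq V$ is called $\sigma$-regular if $$e_{G_R}(X,Y)=(1+\theta)\,\frac{|R||X||Y|}{N}\quad\text{for some real }\theta=\theta(X,Y)\text{ with }|\theta|\le\omega(\sigma,N),$$ for all $X,Y\subseteq V$ with $|X|,|Y|\ge\sigma N$. A set $A\subseteq V$ is called $(\alpha,\sigma)$-bad if there is a $\sigma$-regular set $R\supseteq A$ with $|A|=\alpha|R|$, and $A$ contains no nontrivial three-term arithmetic progression. Theorem. Let $\alpha,\eta>0$. There are constants $c=c(\alpha)>0$, $C=C(\alpha,\eta)>0$ and $\sigma=\sigma(\alpha,\eta)>0$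 such that for all $n$ and all integers $s\ge C N^{1/2}$, the number of $(\alpha,\sigma)$-bad subsets of $V$ of size $s$ is at most $$\eta^{c(\alpha)s}\binom{N}{s}.$$ Here all constants may depend on the fixed prime $p$; $C$ and $\sigma$ may also depend on the error function $\omega$, while $c$ depends on neither $\eta$ nor $\omega$; none of the constants depends on $n$ or $s$. -/

import Mathlib

open Filter

/-- The vector space `V = 𝔽_p^n`. -/
abbrev FpSpace (p n : ℕ) : Type := Fin n → ZMod p

/-- `v₁` is joined to `v₂` in the (bipartite, directed) Cayley graph `G_R` generated by `R`
when `v₂ - v₁ ∈ R`. -/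
def CayleyAdj {p n : ℕ} (R : Finset (FpSpace p n)) (v₁ v₂ : FpSpace p n) : Prop :=
  v₂ - v₁ ∈ R

open Classical in
/-- The number `e_{G_R}(X, Y)` of edges between `X` and `Y` in the Cayley graph `G_R`. -/
noncomputable def cayleyEdges {p n : ℕ} (R X Y : Finset (FpSpace p n)) : ℕ :=
  (Rel.interedges (CayleyAdj R) X Y).card

/-- The error functions `ω(σ, N)` that the symbol `o_σ(1)` stands for: for every `δ > 0`, all
sufficiently small `σ > 0` satisfy `|ω(σ, N)| ≤ δ` for all large `N`. This contains the functions
of `σ` alone tending to `0` as `σ → 0`, and the functions tending to `0` as `N → ∞` for every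
fixed `σ`. -/
def IsLittleOError (ω : ℝ → ℕ → ℝ) : Prop :=
  ∀ δ : ℝ, 0 < δ → ∃ σ₀ : ℝ, 0 < σ₀ ∧ ∀ σ : ℝ, 0 < σ → σ ≤ σ₀ →
    ∀ᶠ N : ℕ in atTop, |ω σ N| ≤ δ

/-- `R ⊆ 𝔽_p^n` is `σ`-regular with error function `ω`: writing `N = |V| = p^n`, we have
`e_{G_R}(X, Y) = (1 + θ) |R| |X| |Y| / N` with `|θ| ≤ ω(σ, N)`, whenever `|X|, |Y| ≥ σ N`. -/
def IsSigmaRegular {p n : ℕ} (ω : ℝ → ℕ → ℝ) (σ : ℝ) (R : Finset (FpSpace p n)) : Prop :=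
  ∀ X Y : Finset (FpSpace p n),
    σ * (p : ℝ) ^ n ≤ (X.card : ℝ) → σ * (p : ℝ) ^ n ≤ (Y.card : ℝ) →
    ∃ θ : ℝ, |θ| ≤ ω σ (p ^ n) ∧
      (cayleyEdges R X Y : ℝ) =
        (1 + θ) * ((R.card : ℝ) * (X.card : ℝ) * (Y.card : ℝ) / (p : ℝ) ^ n)

/-- `A` is `(α, σ)`-bad: it lies in some `σ`-regular set `R` with `|A| = α |R|`, and it contains
no nontrivial three-term arithmetic progression. -/
def IsBad {p n : ℕ} (ω : ℝ → ℕ → ℝ) (α σ : ℝ) (A : Finset (FpSpace p n)) : Prop :=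
  (∃ R : Finset (FpSpace p n),
    IsSigmaRegular ω σ R ∧ A ⊆ R ∧ (A.card : ℝ) = α * (R.card : ℝ)) ∧
  ThreeAPFree (A : Set (FpSpace p n))

/-! The bound already holds for all 3-AP-free `s`-sets in any finite abelian group of order `N` with
injective doubling, by a container argument. Triangle removal gives Varnavides supersaturation
(`le_card_threeAP`): a set X of density at least δ has κN elements that are each the midpoint of κN
progressions in X. For a 3-AP-free I ⊆ X, either I has fewer than q of these midpoints, and the rest
can be discarded, or q of them define a graph on X in which I is independent, and Kleitman–Winston
applies. Both cases record at most 2q elements of I and shrink X by κN/8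
(`exists_smaller_container`). Boundedly many steps bring every container below δN. The condition κq²
≥ 4N, with q proportional to s, is what forces s ≥ C√N. Summing over fingerprints and containers
(`sum_choose_mul_le`) gives (32δ)^(s/2) binom(N, s); take δ = η/32 and c = 1/2. -/

section Containers

open Finset SimpleGraph TripartiteFromTriangles

/-! ### Supersaturation for three-term progressions -/

section Supersaturation

variable {G : Type*} [AddCommGroup G] [Fintype G] [DecidableEq G]

/-- The triples `(a, b, a + b)` with `b - a ∈ X`. In the tripartite graph which they generate, the
triangles `(a, b, c)` correspond to the three-term progressions
`c - 2a, b - a, 2b - c` in `X` together with a base point `a`. -/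
def apTriangleIndices (X : Finset G) : Finset (G × G × G) :=
  {t | t.2.2 = t.1 + t.2.1 ∧ t.2.1 - t.1 ∈ X}

lemma mem_apTriangleIndices {X : Finset G} {a b c : G} :
    (a, b, c) ∈ apTriangleIndices X ↔ c = a + b ∧ b - a ∈ X := by
  simp [apTriangleIndices]

/-- Any two coordinates of (a, b, a + b) determine the third, so the index triangles are
edge-disjoint. -/
instance (X : Finset G) : ExplicitDisjoint (apTriangleIndices X) where
  inj₀ a b c a' h h' := by
    rw [mem_apTriangleIndices] at h h'
    exact add_right_cancel (h.1.symm.trans h'.1)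
  inj₁ a b c b' h h' := by
    rw [mem_apTriangleIndices] at h h'
    exact add_left_cancel (h.1.symm.trans h'.1)
  inj₂ a b c c' h h' := by
    rw [mem_apTriangleIndices] at h h'
    exact h.1.trans h'.1.symm

lemma card_apTriangleIndices (X : Finset G) :
    #(apTriangleIndices X) = Fintype.card G * #X := by
  rw [← card_univ, ← card_product]
  refine (card_nbij' (fun y : G × G ↦ (y.1, y.1 + y.2, y.1 + (y.1 + y.2)))
    (fun t ↦ (t.1, t.2.1 - t.1)) ?_ ?_ ?_ ?_).symm
  · rintro ⟨a, x⟩ h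
    simpa [apTriangleIndices] using h
  · rintro ⟨a, b, c⟩ h
    have := mem_apTriangleIndices.1 h
    simpa using this.2
  · rintro ⟨a, x⟩ h
    simp
  · rintro ⟨a, b, c⟩ h
    have := mem_apTriangleIndices.1 h
    simp [this.1]

/-- **Varnavides' theorem** in finite abelian groups: a dense set contains a positive proportion
of all (possibly trivial) three-term progressions. -/
theorem le_card_threeAP {ε : ℝ} {X : Finset G} (hX : ε * Fintype.card G ≤ #X) :
    27 * triangleRemovalBound (ε / 9) * (Fintype.card G : ℝ) ^ 2 ≤
      #{u ∈ X ×ˢ X | u.2 + u.2 - u.1 ∈ X} := by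
  have hN : (0 : ℝ) < Fintype.card G := by exact_mod_cast Fintype.card_pos
  -- The graph has 3N vertices, and (ε/9)(3N)² = εN² ≤ N|X|, the number of edge-disjoint triangles.
  have hfar : (graph (apTriangleIndices X)).FarFromTriangleFree (ε / 9) := by
    refine farFromTriangleFree _ ?_
    rw [card_apTriangleIndices]
    push_cast
    nlinarith [mul_le_mul_of_nonneg_left hX hN.le]
  have h₁ := hfar.le_card_cliqueFinset
  have h₂ : #((graph (apTriangleIndices X)).cliqueFinset 3) ≤
      #((univ : Finset G) ×ˢ {u ∈ X ×ˢ X | u.2 + u.2 - u.1 ∈ X}) := by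
    refine (card_le_card (t := image (fun w : G × G × G ↦
      toTriangle (w.1, w.1 + w.2.2, w.1 + w.1 + w.2.1)) _) ?_).trans card_image_le
    intro s hs
    rw [mem_cliqueFinset_iff, is3Clique_iff] at hs
    obtain ⟨x, y, z, hxy, hxz, hyz, rfl⟩ := hs
    obtain ⟨a, b, c, habc, hab, hac, hbc⟩ := graph_triple hxy hxz hyz
    obtain ⟨_, hc'⟩ := Graph.in₀₁_iff.1 hab
    obtain ⟨b', hb'⟩ := Graph.in₀₂_iff.1 hac
    obtain ⟨a', ha'⟩ := Graph.in₁₂_iff.1 hbc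
    rw [mem_apTriangleIndices] at hc' hb' ha'
    have e₁ : b' = c - a := eq_sub_of_add_eq' hb'.1.symm
    have e₂ : a' = c - b := eq_sub_of_add_eq ha'.1.symm
    subst e₁ e₂
    refine mem_image.2 ⟨(a, c - a - a, b - a), ?_, ?_⟩
    · simp only [mem_product, mem_univ, mem_filter, true_and]
      refine ⟨⟨hb'.2, hc'.2⟩, ?_⟩
      convert ha'.2 using 1
      abel
    · rw [← habc, toTriangle_apply]
      have e₁ : a + (b - a) = b := by abel
      have e₂ : a + a + (c - a - a) = c := by abel
      simp only [e₁, e₂]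
  rw [card_product, card_univ] at h₂
  have h₃ : (#((graph (apTriangleIndices X)).cliqueFinset 3) : ℝ) ≤
      Fintype.card G * (#{u ∈ X ×ˢ X | u.2 + u.2 - u.1 ∈ X} : ℕ) := by exact_mod_cast h₂
  refine le_of_mul_le_mul_left ?_ hN
  refine le_trans (le_of_eq ?_) (h₁.trans h₃)
  simp only [Fintype.card_sum]
  push_cast
  ring

/-- A dense set has many elements which are the midpoint of many three-term progressions of the
set. -/
theorem exists_popular_midpoints {κ : ℝ} {X : Finset G}
    (hX : 2 * κ * (Fintype.card G : ℝ) ^ 2 ≤ #{u ∈ X ×ˢ X | u.2 + u.2 - u.1 ∈ X}) :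
    ∃ D ⊆ X, κ * Fintype.card G ≤ #D ∧
      ∀ y ∈ D, κ * Fintype.card G ≤ #{x ∈ X | y + y - x ∈ X} := by
  have hN : (0 : ℝ) < Fintype.card G := by exact_mod_cast Fintype.card_pos
  refine ⟨{y ∈ X | κ * Fintype.card G ≤ #{x ∈ X | y + y - x ∈ X}}, filter_subset _ _, ?_,
    fun y hy ↦ (mem_filter.1 hy).2⟩
  have hsum : #{u ∈ X ×ˢ X | u.2 + u.2 - u.1 ∈ X} = ∑ y ∈ X, #{x ∈ X | y + y - x ∈ X} := by
    simp only [card_filter, sum_product_right]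
  rw [hsum] at hX
  push_cast at hX
  rw [← sum_filter_add_sum_filter_not X
    (fun y ↦ κ * Fintype.card G ≤ #{x ∈ X | y + y - x ∈ X})] at hX
  have hcard (s : Finset G) : (#s : ℝ) ≤ Fintype.card G := by exact_mod_cast card_le_univ s
  by_cases hκ : κ ≤ 0
  · exact (mul_nonpos_of_nonpos_of_nonneg hκ hN.le).trans (Nat.cast_nonneg _)
  have hκN : 0 ≤ κ * Fintype.card G := mul_nonneg (not_le.1 hκ).le hN.le
  have h₁ := sum_le_card_nsmul {y ∈ X | κ * Fintype.card G ≤ #{x ∈ X | y + y - x ∈ X}}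
    (fun y ↦ (#{x ∈ X | y + y - x ∈ X} : ℝ)) (Fintype.card G) fun y _ ↦ hcard _
  have h₂ := sum_le_card_nsmul {y ∈ X | ¬ κ * Fintype.card G ≤ #{x ∈ X | y + y - x ∈ X}}
    (fun y ↦ (#{x ∈ X | y + y - x ∈ X} : ℝ)) (κ * Fintype.card G)
    fun y hy ↦ (not_le.1 (mem_filter.1 hy).2).le
  rw [nsmul_eq_mul] at h₁ h₂
  have h₃ := mul_le_mul_of_nonneg_right
    (hcard {y ∈ X | ¬ κ * Fintype.card G ≤ #{x ∈ X | y + y - x ∈ X}}) hκN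
  refine le_of_mul_le_mul_right ?_ hN
  nlinarith

end Supersaturation

/-! ### Containers for independent sets of a graph -/

section GraphContainers

variable {V : Type*} [DecidableEq V]

/-- The **Kleitman–Winston lemma**: every independent set of `r` inside `X` is determined, up to
a subset of a set of small maximum degree, by a small fingerprint. -/
theorem exists_graph_container (r : V → V → Prop) [DecidableRel r] (d : ℝ) (X : Finset V) :
    ∃ ψ : Finset V → Finset V,
      (∀ T, ψ T ⊆ X ∧ ∀ v ∈ ψ T, (#{w ∈ ψ T | r v w} : ℝ) < d) ∧
      ∀ I ⊆ X, (∀ x ∈ I, ∀ y ∈ I, ¬ r x y) → ∃ T ⊆ I, #T * d ≤ #X ∧ I ⊆ T ∪ ψ T := by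
  induction X using Finset.strongInduction with
  | H X ih =>
  by_cases hdeg : ∀ v ∈ X, (#{w ∈ X | r v w} : ℝ) < d
  · exact ⟨fun _ ↦ X, fun _ ↦ ⟨Subset.rfl, hdeg⟩,
      fun I hI _ ↦ ⟨∅, empty_subset _, by simp, by simpa using hI⟩⟩
  push Not at hdeg
  obtain ⟨v, hv, hvd⟩ := hdeg
  -- If v ∉ I, drop v. If v ∈ I, record v and drop its neighbours, at least d of them. Whether v ∈ T
  -- tells the decoder which branch was taken.
  obtain ⟨ψ₁, hψ₁, hI₁⟩ := ih (X.erase v) (erase_ssubset hv)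
  obtain ⟨ψ₂, hψ₂, hI₂⟩ := ih {w ∈ X.erase v | ¬ r v w}
    ((filter_subset _ _).trans_ssubset (erase_ssubset hv))
  refine ⟨fun T ↦ if v ∈ T then ψ₂ (T.erase v) else ψ₁ T, fun T ↦ ?_, fun I hI hind ↦ ?_⟩
  · dsimp only
    split_ifs
    · exact ⟨(hψ₂ _).1.trans ((filter_subset _ _).trans (erase_subset _ _)), (hψ₂ _).2⟩
    · exact ⟨(hψ₁ _).1.trans (erase_subset _ _), (hψ₁ _).2⟩
  by_cases hvI : v ∈ I
  · obtain ⟨T, hT, hTd, hTI⟩ := hI₂ (I.erase v) (fun w hw ↦ by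
      have hw' := mem_of_mem_erase hw
      exact mem_filter.2 ⟨mem_erase.2 ⟨ne_of_mem_erase hw, hI hw'⟩, hind v hvI w hw'⟩)
      (fun x hx y hy ↦ hind x (mem_of_mem_erase hx) y (mem_of_mem_erase hy))
    have hvT : v ∉ T := fun h ↦ notMem_erase v I (hT h)
    refine ⟨insert v T, insert_subset hvI (hT.trans (erase_subset _ _)), ?_, ?_⟩
    · have hle : #{w ∈ X.erase v | ¬ r v w} ≤ #{w ∈ X | ¬ r v w} :=
        card_le_card (filter_subset_filter _ (erase_subset _ _))
      have hsplit := card_filter_add_card_filter_not (s := X) (fun w ↦ r v w)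
      rw [card_insert_of_notMem hvT]
      have hle' : (#{w ∈ X.erase v | ¬ r v w} : ℝ) ≤ #{w ∈ X | ¬ r v w} := by exact_mod_cast hle
      have hsplit' : (#{w ∈ X | r v w} : ℝ) + #{w ∈ X | ¬ r v w} = #X := by exact_mod_cast hsplit
      push_cast
      linarith
    · simp only [mem_insert_self, if_true, erase_insert hvT]
      intro x hx
      by_cases hxv : x = v
      · simp [hxv]
      · have := hTI (mem_erase.2 ⟨hxv, hx⟩)
        rw [insert_union]
        exact mem_insert_of_mem this
  · obtain ⟨T, hT, hTd, hTI⟩ := hI₁ I (fun w hw ↦ mem_erase.2 ⟨fun h ↦ hvI (h ▸ hw), hI hw⟩) hind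
    have hvT : v ∉ T := fun h ↦ hvI (hT h)
    refine ⟨T, hT, hTd.trans ?_, by simpa [hvT] using hTI⟩
    exact_mod_cast card_le_card (erase_subset v X)

/-- If `Y ⊆ X` has maximum degree less than `d` and `X` has maximum degree at most `Δ`, then all
but `d|Y|` edges of `X` meet `X \ Y`. -/
theorem sum_degree_le_of_subset {r : V → V → Prop} [DecidableRel r] (hr : ∀ x y, r x y → r y x)
    {X Y : Finset V} (hYX : Y ⊆ X) {d Δ : ℝ}
    (hY : ∀ v ∈ Y, (#{w ∈ Y | r v w} : ℝ) < d) (hX : ∀ v ∈ X, (#{w ∈ X | r v w} : ℝ) ≤ Δ) :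
    ∑ v ∈ X, (#{w ∈ X | r v w} : ℝ) ≤ #Y * d + 2 * #(X \ Y) * Δ := by
  have h₀ : ∑ v ∈ X, (#{w ∈ X | r v w} : ℝ) =
      ∑ v ∈ X \ Y, (#{w ∈ X | r v w} : ℝ) + ∑ v ∈ Y, (#{w ∈ X | r v w} : ℝ) :=
    (sum_sdiff hYX).symm
  have hsplit (v : V) : (#{w ∈ X | r v w} : ℝ) =
      #{w ∈ X \ Y | r v w} + #{w ∈ Y | r v w} := by
    simp only [card_filter, Nat.cast_sum]
    exact (sum_sdiff hYX).symm
  have hswap : ∑ v ∈ Y, (#{w ∈ X \ Y | r v w} : ℝ) = ∑ w ∈ X \ Y, (#{v ∈ Y | r w v} : ℝ) := by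
    simp only [card_filter, Nat.cast_sum]
    rw [sum_comm]
    refine sum_congr rfl fun w _ ↦ sum_congr rfl fun v _ ↦ ?_
    rw [if_congr ⟨hr v w, hr w v⟩ rfl rfl]
  have h₁ := sum_le_card_nsmul (X \ Y) (fun v ↦ (#{w ∈ X | r v w} : ℝ)) Δ
    fun v hv ↦ hX v (mem_sdiff.1 hv).1
  have h₂ := sum_le_card_nsmul (X \ Y) (fun v ↦ (#{w ∈ Y | r v w} : ℝ)) Δ
    fun v hv ↦ le_trans (by exact_mod_cast card_le_card (filter_subset_filter _ hYX))
      (hX v (mem_sdiff.1 hv).1)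
  have h₃ := sum_le_card_nsmul Y (fun v ↦ (#{w ∈ Y | r v w} : ℝ)) d fun v hv ↦ (hY v hv).le
  rw [nsmul_eq_mul] at h₁ h₂ h₃
  rw [h₀, sum_congr rfl fun v (_ : v ∈ Y) ↦ hsplit v, sum_add_distrib, hswap]
  linarith

end GraphContainers

/-! ### Containers for sets without three-term progressions -/

section APContainers

variable {G : Type*} [AddCommGroup G]

/-- Two distinct points are related when their midpoint lies in `A`. -/
def MidpointRel (A : Finset G) (x z : G) : Prop := x ≠ z ∧ ∃ y ∈ A, x + z = y + y

lemma MidpointRel.symm {A : Finset G} {x z : G} (h : MidpointRel A x z) : MidpointRel A z x :=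
  ⟨h.1.symm, h.2.imp fun _ hy ↦ ⟨hy.1, by rw [add_comm, hy.2]⟩⟩

variable [DecidableEq G]

instance (A : Finset G) : DecidableRel (MidpointRel A) :=
  fun x z ↦ inferInstanceAs (Decidable (x ≠ z ∧ ∃ y ∈ A, x + z = y + y))

lemma card_midpointRel_le (A X : Finset G) (x : G) : #{z ∈ X | MidpointRel A x z} ≤ #A := by
  refine (card_le_card (t := A.image fun y ↦ y + y - x) ?_).trans card_image_le
  intro z hz
  obtain ⟨-, -, y, hy, hxz⟩ := mem_filter.1 hz
  exact mem_image.2 ⟨y, hy, by rw [← hxz, add_sub_cancel_left]⟩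

/-- Each progression with x ≠ y gives the ordered edge (x, 2y - x), and injective doubling recovers
y. The term `#A` pays for the trivial progressions x = y. -/
lemma sum_card_midpoint_le (hG : Function.Injective fun x : G ↦ x + x) (A X : Finset G) :
    ∑ y ∈ A, (#{x ∈ X | y + y - x ∈ X} : ℝ) ≤
      ∑ x ∈ X, (#{z ∈ X | MidpointRel A x z} : ℝ) + #A := by
  have h : ∑ y ∈ A, #{x ∈ X | y + y - x ∈ X ∧ x ≠ y} ≤
      ∑ x ∈ X, #{z ∈ X | MidpointRel A x z} := by
    rw [← card_sigma, ← card_sigma]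
    refine card_le_card_of_injOn (fun u ↦ ⟨u.2, u.1 + u.1 - u.2⟩) ?_ ?_
    · rintro ⟨y, x⟩ h
      simp only [coe_sigma, Set.mem_sigma_iff, mem_coe, mem_filter] at h ⊢
      obtain ⟨hy, hx, hz, hne⟩ := h
      refine ⟨hx, hz, fun h ↦ hne ?_, y, hy, by abel⟩
      exact hG (eq_sub_iff_add_eq.1 h)
    · rintro ⟨y, x⟩ - ⟨y', x'⟩ - h
      simp only [Sigma.mk.injEq, heq_eq_eq] at h
      obtain ⟨rfl, h⟩ := h
      rw [sub_left_inj] at h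
      rw [hG h]
  have h' (y : G) : (#{x ∈ X | y + y - x ∈ X} : ℝ) ≤ #{x ∈ X | y + y - x ∈ X ∧ x ≠ y} + 1 := by
    have : #{x ∈ X | y + y - x ∈ X} ≤ #(insert y {x ∈ X | y + y - x ∈ X ∧ x ≠ y}) := by
      refine card_le_card fun x hx ↦ ?_
      rw [mem_filter] at hx
      by_cases hxy : x = y
      · simp [hxy]
      · exact mem_insert_of_mem (mem_filter.2 ⟨hx.1, hx.2, hxy⟩)
    exact_mod_cast this.trans (card_insert_le _ _)
  refine (sum_le_sum fun y _ ↦ h' y).trans ?_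
  rw [sum_add_distrib, sum_const, nsmul_eq_mul, mul_one]
  gcongr
  exact_mod_cast h

/-- One step of the container algorithm for sets without three-term progressions. -/
theorem exists_smaller_container [Fintype G] (hG : Function.Injective fun x : G ↦ x + x)
    {κ : ℝ} (hκ : 0 < κ) {q : ℕ} (hκN : 2 ≤ κ * Fintype.card G)
    (hq : 4 * Fintype.card G ≤ κ * (q : ℝ) ^ 2) {X D : Finset G} (hDX : D ⊆ X)
    (hD : κ * Fintype.card G ≤ #D)
    (hDy : ∀ y ∈ D, κ * Fintype.card G ≤ #{x ∈ X | y + y - x ∈ X}) :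
    ∃ ψ : Finset G → Finset G → Finset G,
      (∀ A T, #(ψ A T) + κ * Fintype.card G / 8 ≤ #X) ∧
      ∀ I ⊆ X, ThreeAPFree (I : Set G) →
        ∃ A ⊆ I, ∃ T ⊆ I, #A ≤ q ∧ #T ≤ q ∧ I ⊆ A ∪ T ∪ ψ A T := by
  have hN : (0 : ℝ) < Fintype.card G := by exact_mod_cast Fintype.card_pos
  have hq0 : (0 : ℝ) < q := by
    rcases Nat.eq_zero_or_pos q with rfl | h
    · norm_num at hq
      linarith
    · exact_mod_cast h
  choose ψ hψ hψI using fun A : Finset G ↦ exists_graph_container (MidpointRel A) (κ * q / 4) X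
  -- The size of A encodes the case: below q, A is all of I ∩ D; at q, it defines the graph. The
  -- value ∅ is junk.
  refine ⟨fun A T ↦ if #A < q then X \ D else if A ⊆ D ∧ #A = q then ψ A T else ∅,
    fun A T ↦ ?_, fun I hIX hI ↦ ?_⟩
  · dsimp only
    split_ifs with h₁ h₂
    · have := card_sdiff_add_card_eq_card hDX
      have : (#(X \ D) : ℝ) + #D = #X := by exact_mod_cast this
      linarith
    · obtain ⟨hAD, hAq⟩ := h₂
      obtain ⟨hsub, hdeg⟩ := hψ A T
      have hsum := sum_degree_le_of_subset (fun x y ↦ MidpointRel.symm) hsub (Δ := q) hdeg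
        fun v _ ↦ by exact_mod_cast (card_midpointRel_le A X v).trans hAq.le
      have hlow := (card_nsmul_le_sum A _ _ fun y hy ↦ hDy y (hAD hy)).trans
        (sum_card_midpoint_le hG A X)
      rw [nsmul_eq_mul, hAq] at hlow
      have hcard : (#(X \ ψ A T) : ℝ) + #(ψ A T) = #X := by
        exact_mod_cast card_sdiff_add_card_eq_card hsub
      have hψN : (#(ψ A T) : ℝ) ≤ Fintype.card G := by exact_mod_cast card_le_univ _
      -- Of the degree total κNq, at most κNq/4 remains inside ψ and at most κNq/2 is due to trivial
      -- progressions, so 2q|X \ ψ| ≥ κNq/4.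
      have h₃ : (#(ψ A T) : ℝ) * (κ * q / 4) ≤ Fintype.card G * (κ * q / 4) := by gcongr
      have h₄ : 2 * (q : ℝ) ≤ κ * Fintype.card G * q := by gcongr
      have h₅ : q * (κ * Fintype.card G / 8) ≤ q * (#(X \ ψ A T) : ℝ) := by linarith
      have := le_of_mul_le_mul_left h₅ hq0
      linarith
    · have : (#D : ℝ) ≤ #X := by exact_mod_cast card_le_card hDX
      simp only [card_empty, Nat.cast_zero]
      linarith
  · by_cases hlt : #(I ∩ D) < q
    · refine ⟨I ∩ D, inter_subset_left, ∅, empty_subset _, hlt.le, by simp, ?_⟩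
      simp only [if_pos hlt]
      intro x hx
      by_cases hxD : x ∈ D <;> simp [hx, hxD, hIX hx]
    · obtain ⟨A, hA, hAq⟩ := exists_subset_card_eq (not_lt.1 hlt)
      have hAI : A ⊆ I := hA.trans inter_subset_left
      obtain ⟨T, hT, hTd, hTI⟩ := hψI A I hIX (by
        rintro x hx z hz ⟨hne, y, hy, hxyz⟩
        have h₁ := hI (mem_coe.2 hx) (mem_coe.2 (hAI hy)) (mem_coe.2 hz) hxyz
        subst h₁
        exact hne (add_left_cancel hxyz).symm)
      refine ⟨A, hAI, T, hT, hAq.le, ?_, ?_⟩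
      · have hXN : (#X : ℝ) ≤ Fintype.card G := by exact_mod_cast card_le_univ _
        -- Here κq² ≥ 4N is used: |T| · κq/4 ≤ N ≤ κq²/4.
        have : (#T : ℝ) * (κ * q / 4) ≤ q * (κ * q / 4) := by nlinarith
        exact_mod_cast le_of_mul_le_mul_right this (by positivity)
      · simp only [if_neg hAq.not_lt, if_pos (And.intro (hA.trans inter_subset_right) hAq)]
        intro x hx
        have := hTI hx
        rw [union_assoc]
        exact mem_union_right _ this

/-- **Containers for sets without three-term progressions**, with fingerprints `F` contained in
the set. -/
theorem exists_containers [Fintype G] (hG : Function.Injective fun x : G ↦ x + x)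
    {δ κ : ℝ} (hκ : 0 < κ) {q : ℕ} (hκN : 2 ≤ κ * Fintype.card G)
    (hq : 4 * Fintype.card G ≤ κ * (q : ℝ) ^ 2)
    (hsat : ∀ X : Finset G, δ * Fintype.card G ≤ #X →
      2 * κ * (Fintype.card G : ℝ) ^ 2 ≤ #{u ∈ X ×ˢ X | u.2 + u.2 - u.1 ∈ X})
    (k : ℕ) (X : Finset G) (hX : #X ≤ δ * Fintype.card G + k * (κ * Fintype.card G / 8)) :
    ∃ φ : Finset G → Finset (Finset G),
      (∀ F, #(φ F) ≤ (8 ^ k) ^ #F) ∧ (∀ F, ∀ C ∈ φ F, (#C : ℝ) ≤ δ * Fintype.card G) ∧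
      ∀ I ⊆ X, ThreeAPFree (I : Set G) →
        ∃ F ⊆ I, #F ≤ 2 * q * k ∧ ∃ C ∈ φ F, I ⊆ F ∪ C := by
  induction k generalizing X with
  | zero =>
    exact ⟨fun _ ↦ {X}, by simp, by simpa using hX,
      fun I hI _ ↦ ⟨∅, by simp, by simp, X, by simp, by simpa using hI⟩⟩
  | succ k ih =>
    rcases le_total (#X : ℝ) (δ * Fintype.card G) with hX' | hX'
    · exact ⟨fun _ ↦ {X}, fun F ↦ by simpa using Nat.one_le_pow _ _ (by positivity),
        by simpa using hX',
        fun I hI _ ↦ ⟨∅, by simp, by simp, X, by simp, by simpa using hI⟩⟩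
    obtain ⟨D, hDX, hD, hDy⟩ := exists_popular_midpoints (hsat X hX')
    obtain ⟨ψ, hψ, hψI⟩ := exists_smaller_container hG hκ hκN hq hDX hD hDy
    choose φ hφ hφδ hφI using fun A T ↦ ih (ψ A T) (by
      have := hψ A T
      push_cast at hX
      linarith)
    -- The union F of A, T and the later fingerprint forgets its three pieces, so all triples of
    -- subsets of F are tried, a factor of 8^|F| per step.
    refine ⟨fun F ↦ (F.powerset ×ˢ F.powerset ×ˢ F.powerset).biUnion
      fun u ↦ φ u.1 u.2.1 u.2.2, fun F ↦ ?_, fun F C hC ↦ ?_, fun I hI hfree ↦ ?_⟩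
    · refine (card_biUnion_le_card_mul _ _ ((8 ^ k) ^ #F) fun u hu ↦ ?_).trans (le_of_eq ?_)
      · simp only [mem_product, mem_powerset] at hu
        exact (hφ _ _ _).trans (Nat.pow_le_pow_right (by positivity) (card_le_card hu.2.2))
      · rw [card_product, card_product, card_powerset, ← mul_pow, ← mul_pow, ← mul_pow, pow_succ]
        ring
    · simp only [mem_biUnion] at hC
      obtain ⟨u, -, hC⟩ := hC
      exact hφδ _ _ _ _ hC
    · obtain ⟨A, hA, T, hT, hAq, hTq, hAT⟩ := hψI I hI hfree
      obtain ⟨F, hF, hFk, C, hC, hFC⟩ := hφI A T (I ∩ ψ A T) inter_subset_right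
        (hfree.mono (by simp))
      refine ⟨A ∪ T ∪ F, union_subset (union_subset hA hT) (hF.trans inter_subset_left), ?_, C,
        mem_biUnion.2 ⟨(A, T, F), ?_, hC⟩, ?_⟩
      · have h₁ := card_union_le (A ∪ T) F
        have h₂ := card_union_le A T
        rw [mul_add, mul_one]
        omega
      · simp only [mem_product, mem_powerset]
        exact ⟨subset_union_left.trans subset_union_left,
          subset_union_right.trans subset_union_left, subset_union_right⟩
      · intro x hx
        have h₁ := hAT hx
        by_cases hxψ : x ∈ ψ A T
        · have h₂ := hFC (mem_inter.2 ⟨hx, hxψ⟩)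
          simp only [mem_union] at h₂ ⊢
          tauto
        · simp only [mem_union] at h₁ ⊢
          tauto

end APContainers

/-! ### Counting -/

section Counting

/-- Since t ≤ 1, b ≤ tM implies b - 1 ≤ t(M - 1), so each falling-factorial factor gains t. -/
lemma choose_le_pow_mul_choose {t : ℝ} (ht : 0 ≤ t) (ht1 : t ≤ 1) {b M : ℕ}
    (hb : (b : ℝ) ≤ t * M) (j : ℕ) : (b.choose j : ℝ) ≤ t ^ j * M.choose j := by
  induction j generalizing b M with
  | zero => simp
  | succ j ih =>
    rcases b with _ | b
    · simpa using by positivity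
    rcases M with _ | M
    · norm_num at hb
      linarith
    have h := ih (b := b) (M := M) (by push_cast at hb; linarith)
    have e₁ : ((b + 1 : ℕ) : ℝ) * b.choose j = (b + 1).choose (j + 1) * (j + 1 : ℕ) := by
      exact_mod_cast Nat.add_one_mul_choose_eq b j
    have e₂ : ((M + 1 : ℕ) : ℝ) * M.choose j = (M + 1).choose (j + 1) * (j + 1 : ℕ) := by
      exact_mod_cast Nat.add_one_mul_choose_eq M j
    have hj : (0 : ℝ) < (j + 1 : ℕ) := by positivity
    refine le_of_mul_le_mul_right ?_ hj
    rw [← e₁, mul_assoc, ← e₂]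
    calc ((b + 1 : ℕ) : ℝ) * b.choose j ≤ (t * (M + 1 : ℕ)) * (t ^ j * M.choose j) := by gcongr
      _ = _ := by ring

variable {V : Type*} [DecidableEq V] [Fintype V]

/-- The number of `s`-sets with a fingerprint of size at most `r` and a container of size at
most `b`. -/
theorem card_le_of_containers (𝓘 : Finset (Finset V)) {s r b M : ℕ}
    (φ : Finset V → Finset (Finset V))
    (hs : ∀ I ∈ 𝓘, #I = s) (hφ : ∀ F, #(φ F) ≤ M ^ #F) (hb : ∀ F, ∀ C ∈ φ F, #C ≤ b)
    (hφI : ∀ I ∈ 𝓘, ∃ F ⊆ I, #F ≤ r ∧ ∃ C ∈ φ F, I ⊆ F ∪ C) :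
    #𝓘 ≤ ∑ f ∈ range (r + 1), (Fintype.card V).choose f * (M ^ f * b.choose (s - f)) := by
  have hsub : 𝓘 ⊆ (range (r + 1)).biUnion fun f ↦ (powersetCard f univ).biUnion fun F ↦
      (φ F).biUnion fun C ↦ (powersetCard (s - f) C).image (F ∪ ·) := by
    intro I hI
    obtain ⟨F, hF, hFr, C, hC, hIC⟩ := hφI I hI
    simp only [mem_biUnion, mem_image, mem_range, mem_powersetCard]
    refine ⟨#F, by omega, F, ⟨subset_univ _, rfl⟩, C, hC, I \ F, ⟨?_, ?_⟩,
      union_sdiff_of_subset hF⟩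
    · intro x hx
      rw [Finset.mem_sdiff] at hx
      exact (mem_union.1 (hIC hx.1)).resolve_left hx.2
    · rw [card_sdiff_of_subset hF, hs I hI]
  refine (card_le_card hsub).trans (card_biUnion_le.trans (sum_le_sum fun f _ ↦ ?_))
  refine (card_biUnion_le_card_mul _ _ (M ^ f * b.choose (s - f)) fun F hF ↦ ?_).trans
    (by rw [card_powersetCard, card_univ])
  obtain ⟨-, rfl⟩ := mem_powersetCard.1 hF
  refine (card_biUnion_le_card_mul _ _ (b.choose (s - #F)) fun C hC ↦ ?_).trans
    (Nat.mul_le_mul_right _ (hφ F))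
  refine card_image_le.trans ?_
  rw [card_powersetCard]
  exact Nat.choose_le_choose _ (hb F C hC)

/-- As f ≤ s/2 ≤ N/2, one has b ≤ 2δ(N - f), which saves (2δ)^(s - f) ≤ (2δ)^(s/2). The factor `M ^
f` and the sum of binom(s, f) cost 2^s each, and 4^s (2δ)^(s/2) = (32δ)^(s/2). -/
lemma sum_choose_mul_le {N s r b M : ℕ} {δ : ℝ} (hδ : 0 ≤ δ) (hδ1 : 2 * δ ≤ 1)
    (hb : (b : ℝ) ≤ δ * N) (hsN : s ≤ N) (hr : 2 * r ≤ s) (hM : 1 ≤ M) (hMr : M ^ r ≤ 2 ^ s) :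
    ((∑ f ∈ range (r + 1), N.choose f * (M ^ f * b.choose (s - f)) : ℕ) : ℝ) ≤
      (32 * δ) ^ ((1 / 2 : ℝ) * s) * N.choose s := by
  have hterm : ∀ f ∈ range (r + 1), ((N.choose f * (M ^ f * b.choose (s - f)) : ℕ) : ℝ) ≤
      2 ^ s * (2 * δ) ^ ((1 / 2 : ℝ) * s) * N.choose s * s.choose f := by
    intro f hf
    have hfr : f ≤ r := by simpa [Nat.lt_succ_iff] using hf
    have hfs : f ≤ s := by omega
    have h₁ : (b.choose (s - f) : ℝ) ≤ (2 * δ) ^ (s - f) * (N - f).choose (s - f) := by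
      refine choose_le_pow_mul_choose (by positivity) hδ1 ?_ _
      rw [Nat.cast_sub (hfs.trans hsN)]
      have : 2 * (f : ℝ) ≤ N := by exact_mod_cast (by omega : 2 * f ≤ N)
      nlinarith
    have h₂ : (2 * δ) ^ (s - f) ≤ (2 * δ) ^ ((1 / 2 : ℝ) * s) := by
      rw [← Real.rpow_natCast, Nat.cast_sub hfs]
      rcases hδ.eq_or_lt with rfl | hδ'
      · rcases Nat.eq_zero_or_pos s with rfl | hs
        · simp [Nat.le_zero.1 hfs]
        · have hs' : (0 : ℝ) < s := by exact_mod_cast hs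
          have : 2 * (f : ℝ) ≤ s := by exact_mod_cast (by omega : 2 * f ≤ s)
          rw [mul_zero, Real.zero_rpow (by linarith), Real.zero_rpow (by positivity)]
      · refine Real.rpow_le_rpow_of_exponent_ge (by positivity) hδ1 ?_
        have : 2 * (f : ℝ) ≤ s := by exact_mod_cast (by omega : 2 * f ≤ s)
        linarith
    have h₃ : ((M ^ f : ℕ) : ℝ) ≤ 2 ^ s := by
      exact_mod_cast (Nat.pow_le_pow_right hM hfr).trans hMr
    have h₄ : (N.choose s : ℝ) * s.choose f = N.choose f * (N - f).choose (s - f) := by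
      exact_mod_cast Nat.choose_mul hfs
    calc ((N.choose f * (M ^ f * b.choose (s - f)) : ℕ) : ℝ)
        = N.choose f * ((M ^ f : ℕ) * b.choose (s - f)) := by push_cast; ring
      _ ≤ N.choose f * (2 ^ s * ((2 * δ) ^ ((1 / 2 : ℝ) * s) * (N - f).choose (s - f))) := by
          gcongr
          exact h₁.trans (by gcongr)
      _ = 2 ^ s * (2 * δ) ^ ((1 / 2 : ℝ) * s) * (N.choose f * (N - f).choose (s - f)) := by ring
      _ = _ := by rw [← h₄]; ring
  rw [Nat.cast_sum]
  refine (sum_le_sum hterm).trans ?_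
  rw [← mul_sum]
  have hsum : ∑ f ∈ range (r + 1), (s.choose f : ℝ) ≤ 2 ^ s := by
    have h := Nat.sum_range_choose s
    have h' : ∑ f ∈ range (r + 1), s.choose f ≤ 2 ^ s := by
      rw [← h]
      exact sum_le_sum_of_subset (range_subset_range.2 (by omega))
    exact_mod_cast h'
  have h4 : (32 * δ) ^ ((1 / 2 : ℝ) * s) = 2 ^ s * 2 ^ s * (2 * δ) ^ ((1 / 2 : ℝ) * s) := by
    rw [show 32 * δ = 4 ^ (2 : ℝ) * (2 * δ) by norm_num; ring,
      Real.mul_rpow (by positivity) (by positivity), ← Real.rpow_mul (by norm_num),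
      show (2 : ℝ) * (1 / 2 * s) = s by ring, Real.rpow_natCast, ← mul_pow]
    norm_num
  rw [h4]
  calc 2 ^ s * (2 * δ) ^ ((1 / 2 : ℝ) * s) * N.choose s * ∑ f ∈ range (r + 1), (s.choose f : ℝ)
      ≤ 2 ^ s * (2 * δ) ^ ((1 / 2 : ℝ) * s) * N.choose s * 2 ^ s := by gcongr
    _ = _ := by ring

end Counting

/-- In finite abelian groups without elements of order two, there are at most
`η ^ (s / 2) * (|G| choose s)` sets of size `s ≥ C √|G|` without three-term progressions. -/
theorem card_threeAPFree_le {η : ℝ} (hη : 0 < η) :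
    ∃ C : ℝ, 0 < C ∧ ∀ (G : Type) [AddCommGroup G] [Fintype G] [DecidableEq G],
      (Function.Injective fun x : G ↦ x + x) → ∀ (s : ℕ) (𝓘 : Finset (Finset G)),
      C * (Fintype.card G : ℝ) ^ (1 / 2 : ℝ) ≤ s →
      (∀ I ∈ 𝓘, #I = s ∧ ThreeAPFree (I : Set G)) →
      (#𝓘 : ℝ) ≤ η ^ ((1 / 2 : ℝ) * s) * (Fintype.card G).choose s := by
  have htriv (G : Type) [Fintype G] [DecidableEq G] (s : ℕ) (𝓘 : Finset (Finset G))
      (h𝓘 : ∀ I ∈ 𝓘, #I = s) : #𝓘 ≤ (Fintype.card G).choose s := by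
    rw [← card_univ, ← card_powersetCard]
    exact card_le_card fun I hI ↦ mem_powersetCard.2 ⟨subset_univ _, h𝓘 I hI⟩
  rcases le_or_gt 1 η with hη1 | hη1
  · refine ⟨1, one_pos, fun G _ _ _ _ s 𝓘 _ h𝓘 ↦ ?_⟩
    have h₁ : (#𝓘 : ℝ) ≤ (Fintype.card G).choose s := by
      exact_mod_cast htriv G s 𝓘 fun I hI ↦ (h𝓘 I hI).1
    refine h₁.trans (le_mul_of_one_le_left (Nat.cast_nonneg _) ?_)
    exact Real.one_le_rpow hη1 (by positivity)
  set κ : ℝ := 27 / 2 * triangleRemovalBound (η / 32 / 9) with hκdef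
  have hκ : 0 < κ := mul_pos (by norm_num) (triangleRemovalBound_pos (by positivity))
  -- K steps, each losing κN/8, exhaust the whole group.
  set K : ℕ := ⌈8 / κ⌉₊
  have hKκ : 8 / κ ≤ K := Nat.le_ceil _
  have hK1 : 1 ≤ K := Nat.ceil_pos.2 (by positivity)
  have hK1' : (1 : ℝ) ≤ K := by exact_mod_cast hK1
  set C : ℝ := 24 * K ^ 2 * (1 + 1 / κ) with hC
  have hCK : 24 * (K : ℝ) ^ 2 ≤ C := le_mul_of_one_le_right (by positivity)
    (by have : 0 < 1 / κ := by positivity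
        linarith)
  have hκC : 576 * (K : ℝ) ^ 4 ≤ κ * C ^ 2 := by
    have : κ * C ^ 2 = 576 * K ^ 4 * (κ + 2 + 1 / κ) := by
      rw [hC]
      field_simp
      ring
    rw [this]
    refine le_mul_of_one_le_right (by positivity) ?_
    have : 0 < 1 / κ := by positivity
    linarith
  have hCpos : 0 < C := by positivity
  refine ⟨C, hCpos, fun G _ _ _ hG s 𝓘 hs h𝓘 ↦ ?_⟩
  set N := Fintype.card G
  rcases lt_or_ge N s with hNs | hsN
  · have h₀ := htriv G s 𝓘 fun I hI ↦ (h𝓘 I hI).1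
    rw [Nat.choose_eq_zero_of_lt hNs, Nat.le_zero] at h₀
    rw [h₀, Nat.cast_zero]
    positivity
  have hN1 : (1 : ℝ) ≤ N := by exact_mod_cast Fintype.card_pos (α := G)
  have hsN' : (s : ℝ) ≤ N := by exact_mod_cast hsN
  rw [← Real.sqrt_eq_rpow] at hs
  have hsq : √(N : ℝ) ^ 2 = N := Real.sq_sqrt (by positivity)
  have hsq1 : 1 ≤ √(N : ℝ) := Real.one_le_sqrt.2 hN1
  have hsC : C ≤ s := (le_mul_of_one_le_right hCpos.le hsq1).trans hs
  have hCN : C ^ 2 * N ≤ (s : ℝ) ^ 2 := by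
    rw [← hsq, ← mul_pow]
    gcongr
  have hCN' : C ^ 2 ≤ N := by
    have : C ^ 2 * N ≤ N * N := hCN.trans (by rw [sq]; gcongr)
    exact le_of_mul_le_mul_right this (by linarith)
  have hκN : 2 ≤ κ * N := by
    have h₁ : κ * C ^ 2 ≤ κ * N := by gcongr
    have h₂ : (1 : ℝ) ≤ K ^ 4 := one_le_pow₀ hK1'
    linarith
  -- Fingerprints have size at most 2qK, so 6K² makes (8^K)^(2qK) = 2^(6qK²) ≤ 2^s. Rounding loses
  -- at most a factor 2 because s ≥ C ≥ 24K².
  set q : ℕ := s / (6 * K ^ 2) with hqdef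
  have hKpos : 0 < 6 * K ^ 2 := by positivity
  have hqs : q * (6 * K ^ 2) ≤ s := Nat.div_mul_le_self _ _
  have hsq12 : (s : ℝ) ≤ 12 * K ^ 2 * q := by
    have h₁ : s < (q + 1) * (6 * K ^ 2) := by
      have := Nat.lt_mul_div_succ s hKpos
      rwa [mul_comm] at this
    have h₂ : (s : ℝ) < (q + 1) * (6 * K ^ 2) := by exact_mod_cast h₁
    nlinarith
  have hq : 4 * (N : ℝ) ≤ κ * (q : ℝ) ^ 2 := by
    have h₁ : κ * (s : ℝ) ^ 2 ≤ κ * (12 * K ^ 2 * q) ^ 2 := by gcongr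
    have h₂ : κ * (C ^ 2 * N) ≤ κ * (s : ℝ) ^ 2 := by gcongr
    have h₃ : 576 * (K : ℝ) ^ 4 * N ≤ κ * C ^ 2 * N := by gcongr
    have h₄ : 144 * (K : ℝ) ^ 4 * (4 * N) ≤ 144 * (K : ℝ) ^ 4 * (κ * (q : ℝ) ^ 2) := by
      linarith
    exact le_of_mul_le_mul_left h₄ (by positivity)
  obtain ⟨φ, hφ, hφδ, hφI⟩ := exists_containers hG (δ := η / 32) hκ hκN hq
    (fun X hX ↦ by
      refine le_trans (le_of_eq ?_) (le_card_threeAP hX)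
      rw [hκdef]
      ring) K univ (by
      have h₁ : 8 ≤ K * κ := (div_le_iff₀ hκ).1 hKκ
      have h₂ : 8 * (N : ℝ) ≤ K * κ * N := by gcongr
      have h₃ : 0 ≤ η / 32 * N := by positivity
      rw [card_univ]
      linarith)
  have hcount := card_le_of_containers 𝓘 (s := s) (r := 2 * q * K) (b := ⌊η / 32 * N⌋₊)
    (M := 8 ^ K) φ (fun I hI ↦ (h𝓘 I hI).1) hφ (fun F D hD ↦ Nat.le_floor (hφδ F D hD))
    fun I hI ↦ hφI I (subset_univ _) (h𝓘 I hI).2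
  have hcount' := (Nat.cast_le (α := ℝ)).2 hcount
  refine hcount'.trans ((sum_choose_mul_le (δ := η / 32) (by positivity) (by linarith)
    (Nat.floor_le (by positivity)) hsN ?_ (Nat.one_le_pow _ _ (by norm_num)) ?_).trans
    (le_of_eq ?_))
  · calc 2 * (2 * q * K) = q * (4 * K) := by ring
      _ ≤ q * (6 * K ^ 2) := Nat.mul_le_mul_left q (by nlinarith)
      _ ≤ s := hqs
  · calc (8 ^ K) ^ (2 * q * K) = 2 ^ (q * (6 * K ^ 2)) := by
          rw [show 8 = 2 ^ 3 by norm_num, ← pow_mul, ← pow_mul]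
          ring_nf
      _ ≤ 2 ^ s := Nat.pow_le_pow_right (by norm_num) hqs
  · rw [show 32 * (η / 32) = η by ring]

end Containers

theorem mainTheorem4 (p : ℕ) [Fact p.Prime] (hp : p ≠ 2) (α : ℝ) (hα : 0 < α) :
    ∃ c : ℝ, 0 < c ∧
      ∀ η : ℝ, 0 < η → ∀ ω : ℝ → ℕ → ℝ, IsLittleOError ω →
        ∃ C : ℝ, 0 < C ∧ ∃ σ : ℝ, 0 < σ ∧
          ∀ n s : ℕ, C * ((p : ℝ) ^ n) ^ (1 / 2 : ℝ) ≤ (s : ℝ) →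
            (Set.ncard {A : Finset (FpSpace p n) | A.card = s ∧ IsBad ω α σ A} : ℝ) ≤
              η ^ (c * (s : ℝ)) * ((p ^ n).choose s : ℝ) := by
  classical
  refine ⟨1 / 2, by norm_num, fun η hη ω _ ↦ ?_⟩
  obtain ⟨C, hC, hcount⟩ := card_threeAPFree_le hη
  -- Any positive σ would do, as the count covers every 3-AP-free set of size s.
  refine ⟨C, hC, 1, one_pos, fun n s hs ↦ ?_⟩
  have hcard : Fintype.card (FpSpace p n) = p ^ n := by simp [FpSpace, ZMod.card]
  have h2 : (2 : ZMod p) ≠ 0 := Ring.two_ne_zero (by rwa [ZMod.ringChar_zmod_n])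
  have hinj : Function.Injective fun x : FpSpace p n ↦ x + x := by
    intro x y hxy
    funext i
    have h := congrFun hxy i
    simp only [Pi.add_apply, ← two_mul] at h
    exact mul_left_cancel₀ h2 h
  have h := hcount (FpSpace p n) hinj s
    (Set.toFinite {A : Finset (FpSpace p n) | A.card = s ∧ IsBad ω α 1 A}).toFinset
    (by rw [hcard]; exact_mod_cast hs)
    (fun A hA ↦ by
      obtain ⟨hAs, hbad⟩ := (Set.Finite.mem_toFinset _).1 hA
      exact ⟨hAs, hbad.2⟩)
  rwa [← Set.ncard_eq_toFinset_card, hcard] at h
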